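/- Let $\mathbb D=\{z\in\mathbb C:|z|<1\}$, $\mathbb D^*=\{z\in\mathbb C: 0<|z|<1\}$ and $\widehat{\mathbb C}=\mathbb C\cup\{\infty\}$. Let $f:\mathbb D^*\to\widehat{\mathbb C}$ be a locally injective holomorphic map, and let $S_f$ be its Schwarzian derivative, that is, $$S_f(z)=\frac{f'''(z)}{f'(z)}-\frac32\left(\frac{f''(z)}{f'(z)}\right)^2\ \text{ if } f(z)\neq\infty,\qquad S_f(z)=\lim_{w\to z}S_f(w)\ \text{ if } f(z)=\infty .$$ Then: (i) The origin is not a simple pole of $S_f$. (ii) If the origin is a double pole of $S_f$, then $f$ extends to a holomorphic map $\mathbb D\to\widehat{\mathbb C}$ with a critical point at $0$. Moreover, in this case there is an integer $d\ge 2$ such that the Laurent expansion of $S_f$ at $0$ has the form $$S_f(z)=\frac{1-d^2}{2z^2}+\frac{a_1}{z}+a_2+a_3z+\cdots$$ and its coefficients satisfy $$\det\begin{pmatrix} a_1&k_1&0&\cdots&0\\ a_2&a_1&k_2&\cdots&0\\ \vdots&\vdots&\vdots&&\vdots\\ a_{d-1}&a_{d-2}&a_{d-3}&\cdots&k_{d-1}\\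 a_d&a_{d-1}&a_{d-2}&\cdots&a_1\end{pmatrix}=0,\qquad k_j=2j(j-d),\ 1\le j\le d-1.$$ -/

import Mathlib

open Filter Topology Set

/-- The punctured unit disc `{z : 0 < |z| < 1}`. -/
def puncturedDisc : Set ℂ := {z : ℂ | 0 < ‖z‖ ∧ ‖z‖ < 1}

namespace RiemannSphere

/-- The affine coordinate `w` on the Riemann sphere `ℂ ∪ {∞}`
(with the irrelevant value `0` at `∞`, outside the domain of the chart). -/
def coordFinite (p : OnePoint ℂ) : ℂ := p.elim 0 (fun w => w)

/-- The coordinate `1 / w` on the Riemann sphere, centred at `∞`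
(with the irrelevant value `0` at `0`, outside the domain of the chart). -/
noncomputable def coordInfty (p : OnePoint ℂ) : ℂ := p.elim 0 (fun w => w⁻¹)

/-- A map into the Riemann sphere is holomorphic at `z` if it is continuous at `z` and is
holomorphic near `z` when it is read in a coordinate centred at, or finite at, `f z`. -/
def HolomorphicAt (f : ℂ → OnePoint ℂ) (z : ℂ) : Prop :=
  ContinuousAt f z ∧
    (f z ≠ OnePoint.infty → AnalyticAt ℂ (fun w => coordFinite (f w)) z) ∧
    (f z = OnePoint.infty → AnalyticAt ℂ (fun w => coordInfty (f w)) z)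

/-- Holomorphic at every point of a set. The set is open wherever this is used. -/
def HolomorphicOn (f : ℂ → OnePoint ℂ) (U : Set ℂ) : Prop :=
  ∀ z ∈ U, HolomorphicAt f z

/-- Every point of `U` has a neighbourhood on which `f` is injective.
The set is open wherever this is used. -/
def LocallyInjectiveOn (f : ℂ → OnePoint ℂ) (U : Set ℂ) : Prop :=
  ∀ z ∈ U, ∃ V ∈ 𝓝 z, InjOn f V

/-- A point where the derivative, read in a coordinate at `f z`, vanishes
(meaningful for `f` holomorphic at `z`). -/
def IsCriticalPoint (f : ℂ → OnePoint ℂ) (z : ℂ) : Prop :=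
  (f z ≠ OnePoint.infty → deriv (fun w => coordFinite (f w)) z = 0) ∧
    (f z = OnePoint.infty → deriv (fun w => coordInfty (f w)) z = 0)

/-- The expression `g''' / g' - (3 / 2) (g'' / g') ^ 2` for a complex-valued function. -/
noncomputable def schwarzianFinite (g : ℂ → ℂ) (z : ℂ) : ℂ :=
  iteratedDeriv 3 g z / deriv g z - 3 / 2 * (iteratedDeriv 2 g z / deriv g z) ^ 2

open Classical in
/-- The Schwarzian derivative of a map into the Riemann sphere: the usual expression where `f` is
finite, and the limit of that expression at the points where `f` takes the value `∞`. -/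
noncomputable def schwarzian (f : ℂ → OnePoint ℂ) (z : ℂ) : ℂ :=
  if f z = OnePoint.infty then
    limUnder (𝓝[≠] z) (schwarzianFinite fun w => coordFinite (f w))
  else schwarzianFinite (fun w => coordFinite (f w)) z

end RiemannSphere

/-- `φ(z) = a₀ / z² + a₁ / z + a₂ + a₃ z + ⋯` in a punctured neighbourhood of the origin. -/
def HasLaurentExpansion (φ : ℂ → ℂ) (a : ℕ → ℂ) : Prop :=
  ∀ᶠ z in 𝓝[≠] (0 : ℂ), HasSum (fun n : ℕ => a n * z ^ ((n : ℤ) - 2)) (φ z)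

/-- The `d × d` matrix
`a₁      k₁      0     ⋯  0`
`a₂      a₁      k₂    ⋯  0`
`⋮`
`a_{d-1} a_{d-2}       ⋯  k_{d-1}`
`a_d     a_{d-1}       ⋯  a₁`
with `k_j = 2 j (j - d)`. Rows and columns are numbered from `0`. -/
def coefficientMatrix (d : ℕ) (a : ℕ → ℂ) : Matrix (Fin d) (Fin d) ℂ :=
  Matrix.of fun i j =>
    if (j : ℕ) ≤ (i : ℕ) then a ((i : ℕ) - (j : ℕ) + 1)
    else if (j : ℕ) = (i : ℕ) + 1 then 2 * ((j : ℕ) : ℂ) * (((j : ℕ) : ℂ) - (d : ℂ))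
    else 0

open RiemannSphere

/-! Let `g` be the affine coordinate of `f` and `S` its Schwarzian. For any local coordinate `h`
with Schwarzian `S`, the functions `(α + β h + γ h²) / h'` solve the linear equation `y''' + 2 S y'
+ S' y = 0`. Passing from `g` to `1 / g` only permutes the quadratics up to sign, so `1 / g'` and `g
/ g'` are single-valued analytic solutions on the whole punctured disc, poles of `g` included. If
`S` has a pole of order at most two, the origin is a regular singular point: Grönwall bounds
solutions by a power of `1 / |z|`, so they are meromorphic at `0`, and so is their quotient `g`.
Hence `f` extends (`exists_holomorphic_extension`).

Let `H` be a coordinate of the extension, `d - 1` the order of vanishing of `H'`, and write `H' =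
z^(d-1) / v²` with `v 0 ≠ 0`. With `θ = z d/dz`, this gives `z² S = (1 - d²)/2 + (-2 θ²v + 2 d θv) /
v`. If `d = 1`, `S` is analytic at `0`; if `d ≥ 2`, the leading coefficient is nonzero and the pole
is exactly double. So simple poles do not occur. Comparing Taylor coefficients gives a recursion for
those of `v`, whose coefficient of index `d` drops out of the `d`-th equation; the first `d`
coefficients then form a nonzero kernel vector of the matrix. -/

/-! ### The Schwarzian derivative and its third-order linear equation. -/

theorem AnalyticAt.eventually_deriv_ne_zero {h : ℂ → ℂ} {z : ℂ} (hh : AnalyticAt ℂ h z)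
    (h' : deriv h z ≠ 0) : ∀ᶠ w in 𝓝 z, AnalyticAt ℂ h w ∧ deriv h w ≠ 0 :=
  hh.eventually_analyticAt.and (hh.deriv.continuousAt.eventually_ne h')

/-- The Schwarzian derivative in terms of the pre-Schwarzian `h'' / h'`. -/
theorem schwarzianFinite_eq_preSchwarzian {h : ℂ → ℂ} {z : ℂ} (hh : AnalyticAt ℂ h z)
    (h' : deriv h z ≠ 0) :
    schwarzianFinite h z =
      deriv (fun w => deriv (deriv h) w / deriv h w) z - (deriv (deriv h) z / deriv h z) ^ 2 / 2 := by
  have e : deriv (fun w => deriv (deriv h) w / deriv h w) z = _ :=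
    (hh.deriv.deriv.differentiableAt.hasDerivAt.div hh.deriv.differentiableAt.hasDerivAt h').deriv
  rw [e]
  simp only [schwarzianFinite, iteratedDeriv_succ, iteratedDeriv_zero]
  field_simp
  ring

theorem schwarzianFinite_congr {g h : ℂ → ℂ} {z : ℂ} (e : g =ᶠ[𝓝 z] h) :
    schwarzianFinite g z = schwarzianFinite h z := by
  simp only [schwarzianFinite, iteratedDeriv_succ, iteratedDeriv_zero]
  rw [e.deriv_eq, e.deriv.deriv_eq, e.deriv.deriv.deriv_eq]

theorem AnalyticAt.schwarzianFinite {h : ℂ → ℂ} {z : ℂ} (hh : AnalyticAt ℂ h z)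
    (h' : deriv h z ≠ 0) : AnalyticAt ℂ (schwarzianFinite h) z := by
  have h1 := hh.deriv
  have h2 := hh.deriv.deriv
  have h3 := hh.deriv.deriv.deriv
  unfold RiemannSphere.schwarzianFinite
  simp only [iteratedDeriv_succ, iteratedDeriv_zero]
  exact (h3.div h1 h').sub (analyticAt_const.mul ((h2.div h1 h').pow 2))

/-- The Schwarzian derivative is invariant under inversion. -/
theorem schwarzianFinite_inv {h : ℂ → ℂ} {z : ℂ} (hh : AnalyticAt ℂ h z)
    (h' : deriv h z ≠ 0) (h0 : h z ≠ 0) : schwarzianFinite h⁻¹ z = schwarzianFinite h z := by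
  have hev := hh.eventually_deriv_ne_zero h'
  have hne := hh.continuousAt.eventually_ne h0
  have d1 : deriv h⁻¹ =ᶠ[𝓝 z] fun w => -deriv h w / h w ^ 2 := by
    filter_upwards [hev, hne] with w hw hw0
    exact (hw.1.differentiableAt.hasDerivAt.inv hw0).deriv
  have pre : (fun w => deriv (deriv h⁻¹) w / deriv h⁻¹ w) =ᶠ[𝓝 z]
      fun w => deriv (deriv h) w / deriv h w - 2 * (deriv h w / h w) := by
    filter_upwards [hev, hne, d1, d1.eventuallyEq_nhds] with w hw hw0 e1 e2
    have : deriv (fun w => -deriv h w / h w ^ 2) w = _ :=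
      (hw.1.deriv.differentiableAt.hasDerivAt.neg.div
        (hw.1.differentiableAt.hasDerivAt.pow 2) (pow_ne_zero 2 hw0)).deriv
    rw [e1, e2.deriv_eq, this]
    have := hw.2
    simp only [Pi.neg_apply, Pi.pow_apply]
    field_simp
    ring
  have hinv : AnalyticAt ℂ h⁻¹ z := hh.inv h0
  have hinv' : deriv h⁻¹ z ≠ 0 := by
    rw [d1.self_of_nhds]
    exact div_ne_zero (neg_ne_zero.2 h') (pow_ne_zero 2 h0)
  rw [schwarzianFinite_eq_preSchwarzian hinv hinv', schwarzianFinite_eq_preSchwarzian hh h',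
    pre.deriv_eq, show deriv (deriv h⁻¹) z / deriv h⁻¹ z = _ from pre.self_of_nhds]
  have hN : DifferentiableAt ℂ (fun w => deriv (deriv h) w / deriv h w) z :=
    (hh.deriv.deriv.div hh.deriv h').differentiableAt
  have : deriv (fun w => deriv (deriv h) w / deriv h w - 2 * (deriv h w / h w)) z = _ :=
    (hN.hasDerivAt.sub ((hh.deriv.differentiableAt.hasDerivAt.div
      hh.differentiableAt.hasDerivAt h0).const_mul 2)).deriv
  rw [this]
  field_simp
  ring

/-- A quadratic polynomial in `h` divided by `h'` solves `y''' + 2 S y' + S' y = 0`,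
written as a first-order equation for `y'' + S y`. -/
theorem hasDerivAt_of_quadratic_div_deriv {h y S : ℂ → ℂ} {z : ℂ} (α β γ : ℂ)
    (hh : AnalyticAt ℂ h z) (h' : deriv h z ≠ 0) (hS : S =ᶠ[𝓝 z] schwarzianFinite h)
    (hy : y =ᶠ[𝓝 z] fun w => (α + β * h w + γ * h w ^ 2) / deriv h w) :
    AnalyticAt ℂ y z ∧
      HasDerivAt (fun w => deriv (deriv y) w + S w * y w) (-S z * deriv y z) z := by
  set N : ℂ → ℂ := fun w => deriv (deriv h) w / deriv h w with hN
  have hev := hh.eventually_deriv_ne_zero h'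
  have hNa : ∀ᶠ w in 𝓝 z, AnalyticAt ℂ N w := by
    filter_upwards [hev] with w hw using hw.1.deriv.deriv.div hw.1.deriv hw.2
  have hya : AnalyticAt ℂ y z := by
    refine AnalyticAt.congr ?_ hy.symm
    exact ((analyticAt_const.add (analyticAt_const.mul hh)).add
      (analyticAt_const.mul (hh.pow 2))).div hh.deriv h'
  have y1 : deriv y =ᶠ[𝓝 z] fun w => β + 2 * γ * h w - y w * N w := by
    filter_upwards [hev, hy, hy.eventuallyEq_nhds] with w hw e e2
    have hd := hw.1.differentiableAt.hasDerivAt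
    have : deriv (fun w => (α + β * h w + γ * h w ^ 2) / deriv h w) w = _ :=
      ((((hd.const_mul β).const_add α).add ((hd.pow 2).const_mul γ)).div
        hw.1.deriv.differentiableAt.hasDerivAt hw.2).deriv
    rw [e2.deriv_eq, this, e]
    have := hw.2
    simp only [hN, Pi.add_apply, Pi.pow_apply]
    field_simp
    ring
  have y2 : deriv (deriv y) =ᶠ[𝓝 z] fun w => 2 * γ * deriv h w - deriv y w * N w - y w * deriv N w := by
    filter_upwards [hev, y1.eventuallyEq_nhds, hNa, hya.eventually_analyticAt] with w hw e2 hn hyw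
    have : deriv (fun w => β + 2 * γ * h w - y w * N w) w = _ :=
      (((hw.1.differentiableAt.hasDerivAt.const_mul (2 * γ)).const_add β).sub
        (hyw.differentiableAt.hasDerivAt.mul hn.differentiableAt.hasDerivAt)).deriv
    rw [e2.deriv_eq, this]
    ring
  have hSw : ∀ᶠ w in 𝓝 z, S w = deriv N w - N w ^ 2 / 2 := by
    filter_upwards [hev, hS] with w hw e
    rw [e, schwarzianFinite_eq_preSchwarzian hw.1 hw.2]
  -- Substituting `S = N' - N²/2` cancels the term `y N'`, so differentiating once more never
  -- involves `S'`.
  have key : (fun w => deriv (deriv y) w + S w * y w) =ᶠ[𝓝 z]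
      fun w => 2 * γ * deriv h w - deriv y w * N w - y w * (N w ^ 2 / 2) := by
    filter_upwards [y2, hSw] with w e2 es
    rw [e2, es]; ring
  refine ⟨hya, HasDerivAt.congr_of_eventuallyEq ?_ key⟩
  have hNd := hNa.self_of_nhds.differentiableAt.hasDerivAt
  refine (((hh.deriv.differentiableAt.hasDerivAt.const_mul (2 * γ)).sub
    (hya.deriv.differentiableAt.hasDerivAt.mul hNd)).sub
    (hya.differentiableAt.hasDerivAt.mul ((hNd.pow 2).div_const 2))).congr_deriv ?_
  have hN2 : deriv (deriv h) z = N z * deriv h z := by simp only [hN]; field_simp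
  simp only [y2.self_of_nhds, hSw.self_of_nhds, hN2, Pi.pow_apply]
  ring

/-! ### Analytic roots and injectivity. -/

/-- A nonvanishing analytic function has analytic `n`-th roots. -/
theorem AnalyticAt.exists_pow_eventuallyEq {h : ℂ → ℂ} {z : ℂ} (hh : AnalyticAt ℂ h z)
    (h0 : h z ≠ 0) {n : ℕ} (hn : n ≠ 0) :
    ∃ v : ℂ → ℂ, AnalyticAt ℂ v z ∧ v z ≠ 0 ∧ ∀ᶠ w in 𝓝 z, v w ^ n = h w := by
  -- Dividing by `h z` moves the base value to `1`, where the principal power is analytic; `c`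
  -- restores the constant.
  obtain ⟨c, hc⟩ := IsAlgClosed.exists_pow_nat_eq (h z) (Nat.pos_of_ne_zero hn)
  have hp : ∀ w, (c * (h w / h z) ^ ((n : ℂ)⁻¹)) ^ n = h w := by
    intro w
    rw [mul_pow, hc, Complex.cpow_nat_inv_pow _ hn]
    field_simp
  refine ⟨fun w => c * (h w / h z) ^ ((n : ℂ)⁻¹), ?_, ?_, Eventually.of_forall hp⟩
  · refine analyticAt_const.mul ((hh.div analyticAt_const h0).cpow analyticAt_const ?_)
    simp [h0]
  · intro e
    apply h0
    rw [← hp z]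
    exact (congrArg (· ^ n) e).trans (zero_pow hn)

/-- If the derivative vanished, `f - f z` would be `φ ^ n` with `n ≥ 2` and `φ` a local coordinate.
The points where `φ` equals `ε/2` and `ζ ε/2`, with `ζ` a primitive `n`-th root of unity, would then
share a value. -/
theorem AnalyticAt.deriv_ne_zero_of_injOn {f : ℂ → ℂ} {z : ℂ} (hf : AnalyticAt ℂ f z)
    {V : Set ℂ} (hV : V ∈ 𝓝 z) (hi : InjOn f V) : deriv f z ≠ 0 := by
  intro hd
  have hfa : AnalyticAt ℂ (fun w => f w - f z) z := hf.sub analyticAt_const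
  have htop : analyticOrderAt (fun w => f w - f z) z ≠ ⊤ := by
    intro ht
    rw [analyticOrderAt_eq_top] at ht
    have : ∃ᶠ w in 𝓝[≠] z, w ∈ V ∧ f w - f z = 0 :=
      ((eventually_mem_set.2 (mem_nhdsWithin_of_mem_nhds hV)).and
        (ht.filter_mono nhdsWithin_le_nhds)).frequently
    obtain ⟨w, ⟨hw, e⟩, hne⟩ := (this.and_eventually self_mem_nhdsWithin).exists
    exact hne (hi hw (mem_of_mem_nhds hV) (sub_eq_zero.1 e))
  obtain ⟨h, hh, h0, he⟩ := hfa.analyticOrderAt_ne_top.1 htop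
  set n := analyticOrderNatAt (fun w => f w - f z) z with hn
  have hn0 : n ≠ 0 := by
    intro e
    have := he.self_of_nhds
    rw [e] at this
    simp at this
    exact h0 this.symm
  have hn1 : n ≠ 1 := by
    intro e
    rw [e] at he
    have h1 : deriv f z = deriv (fun w => f w - f z) z := by simp
    have h2 : deriv (fun w => (w - z) ^ 1 • h w) z = _ :=
      ((((hasDerivAt_id z).sub_const z).pow 1).mul hh.differentiableAt.hasDerivAt).deriv
    rw [Filter.EventuallyEq.deriv_eq he, h2, hd] at h1
    simp at h1
    exact h0 h1.symm
  obtain ⟨v, hva, hv0, hv⟩ := hh.exists_pow_eventuallyEq h0 hn0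
  set φ : ℂ → ℂ := fun w => (w - z) * v w with hφ
  have hφd : HasStrictDerivAt φ (v z) z := by
    have : AnalyticAt ℂ φ z := (analyticAt_id.sub analyticAt_const).mul hva
    have h3 : HasDerivAt φ _ z :=
      ((hasDerivAt_id z).sub_const z).mul hva.differentiableAt.hasDerivAt
    have := this.hasStrictDerivAt
    rw [h3.deriv] at this
    simpa using this
  have hmap := hφd.map_nhds_eq hv0
  have hφz : φ z = 0 := by simp [hφ]
  have hW : {w | w ∈ V ∧ φ w ^ n = f w - f z} ∈ 𝓝 z := by
    filter_upwards [hV, hv, he] with w h1 h2 h3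
    refine ⟨h1, ?_⟩
    rw [h3, hφ]
    simp only [mul_pow, h2, smul_eq_mul]
  have himg : φ '' {w | w ∈ V ∧ φ w ^ n = f w - f z} ∈ 𝓝 (0 : ℂ) := by
    rw [← hφz, ← hmap]; exact image_mem_map hW
  obtain ⟨ε, hε, hb⟩ := Metric.mem_nhds_iff.1 himg
  have hζ := Complex.isPrimitiveRoot_exp n hn0
  set ζ := Complex.exp (2 * Real.pi * Complex.I / n)
  have hζn : ‖ζ‖ = 1 := Complex.norm_eq_one_of_pow_eq_one hζ.pow_eq_one hn0
  have hm : ‖((ε / 2 : ℝ) : ℂ)‖ < ε := by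
    rw [Complex.norm_real, Real.norm_of_nonneg (by positivity)]; linarith
  obtain ⟨a, ⟨ha, ha'⟩, hae⟩ := hb (show ((ε / 2 : ℝ) : ℂ) ∈ Metric.ball (0 : ℂ) ε by
    simpa using hm)
  obtain ⟨b, ⟨hb, hb'⟩, hbe⟩ := hb (show ζ * ((ε / 2 : ℝ) : ℂ) ∈ Metric.ball (0 : ℂ) ε by
    rw [mem_ball_zero_iff, norm_mul, hζn, one_mul]; exact hm)
  have hab : a = b := by
    apply hi ha hb
    rw [hae] at ha'
    rw [hbe, mul_pow, hζ.pow_eq_one, one_mul, ha'] at hb'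
    exact sub_left_injective hb'
  rw [hab, hbe] at hae
  have : ζ = 1 := by
    have h2 : ((ε / 2 : ℝ) : ℂ) ≠ 0 := by exact_mod_cast (by positivity : ε / 2 ≠ 0)
    exact mul_right_cancel₀ h2 (by rw [hae, one_mul])
  exact hζ.ne_one (by omega) this

/-! ### Local coordinates on the sphere. -/

theorem RiemannSphere.coordInfty_eq_inv (p : OnePoint ℂ) : coordInfty p = (coordFinite p)⁻¹ := by
  induction p using OnePoint.rec with
  | infty => exact inv_zero.symm
  | coe w => rfl

theorem RiemannSphere.coe_coordFinite {p : OnePoint ℂ} (hp : p ≠ OnePoint.infty) :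
    (coordFinite p : OnePoint ℂ) = p := by
  induction p using OnePoint.rec with
  | infty => exact absurd rfl hp
  | coe w => rfl

/-- Near `z`, either `g` or `1 / g` (vanishing at `z`) is a local coordinate, with Schwarzian
derivative `S`. -/
def IsLocalCoordinateWith (g S : ℂ → ℂ) (z : ℂ) : Prop :=
  (AnalyticAt ℂ g z ∧ deriv g z ≠ 0 ∧ S =ᶠ[𝓝 z] schwarzianFinite g) ∨
    (AnalyticAt ℂ g⁻¹ z ∧ g z = 0 ∧ deriv g⁻¹ z ≠ 0 ∧ S =ᶠ[𝓝 z] schwarzianFinite g⁻¹)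

theorem isLocalCoordinateWith_of_ne_infty {f : ℂ → OnePoint ℂ} {z : ℂ} (hf : HolomorphicAt f z)
    {V : Set ℂ} (hV : V ∈ 𝓝 z) (hi : InjOn f V) (hz : f z ≠ OnePoint.infty) :
    AnalyticAt ℂ (fun w => coordFinite (f w)) z ∧ deriv (fun w => coordFinite (f w)) z ≠ 0 ∧
      schwarzian f =ᶠ[𝓝 z] schwarzianFinite (fun w => coordFinite (f w)) := by
  have hne : ∀ᶠ w in 𝓝 z, f w ≠ OnePoint.infty := hf.1.eventually_ne hz
  have ha := hf.2.1 hz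
  refine ⟨ha, ha.deriv_ne_zero_of_injOn (inter_mem hV hne) ?_, ?_⟩
  · rintro a ⟨ha, ha'⟩ b ⟨hb, hb'⟩ e
    apply hi ha hb
    rw [← coe_coordFinite ha', ← coe_coordFinite hb']
    exact congrArg _ e
  · filter_upwards [hne] with w hw
    simp only [schwarzian, if_neg hw]

/-- Away from `z` the coordinate at `∞` is nonzero and inversion invariance applies; at `z` itself
the limit defining `schwarzian` is found from analyticity of the Schwarzian of `1 / g`. -/
theorem isLocalCoordinateWith_of_eq_infty {f : ℂ → OnePoint ℂ} {z : ℂ} (hf : HolomorphicAt f z)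
    {V : Set ℂ} (hV : V ∈ 𝓝 z) (hi : InjOn f V) (hz : f z = OnePoint.infty) :
    AnalyticAt ℂ (fun w => coordFinite (f w))⁻¹ z ∧ coordFinite (f z) = 0 ∧
      deriv (fun w => coordFinite (f w))⁻¹ z ≠ 0 ∧
      schwarzian f =ᶠ[𝓝 z] schwarzianFinite (fun w => coordFinite (f w))⁻¹ := by
  set g : ℂ → ℂ := fun w => coordFinite (f w) with hg
  have hk : (fun w => coordInfty (f w)) = g⁻¹ := funext fun w => coordInfty_eq_inv _
  -- `coordInfty` sends both `0` and `∞` to `0`, so it is injective only once the value `0` is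
  -- excluded.
  have hne : ∀ᶠ w in 𝓝 z, f w ≠ ((0 : ℂ) : OnePoint ℂ) :=
    hf.1.eventually_ne (by rw [hz]; exact OnePoint.infty_ne_coe 0)
  have ha : AnalyticAt ℂ g⁻¹ z := hk ▸ hf.2.2 hz
  have hgz : coordFinite (f z) = 0 := by rw [hz]; rfl
  have hd : deriv g⁻¹ z ≠ 0 := by
    refine ha.deriv_ne_zero_of_injOn (inter_mem hV hne) ?_
    rintro a ⟨ha, ha'⟩ b ⟨hb, hb'⟩ e
    apply hi ha hb
    have e' : coordFinite (f a) = coordFinite (f b) := inv_injective e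
    by_cases h1 : f a = OnePoint.infty <;> by_cases h2 : f b = OnePoint.infty
    · rw [h1, h2]
    · exact absurd (by rw [← coe_coordFinite h2, ← e', h1]; rfl) hb'
    · exact absurd (by rw [← coe_coordFinite h1, e', h2]; rfl) ha'
    · rw [← coe_coordFinite h1, e', coe_coordFinite h2]
  have hev := ha.eventually_deriv_ne_zero hd
  have hne0 : ∀ᶠ w in 𝓝[≠] z, g⁻¹ w ≠ 0 := by
    have := ha.differentiableAt.hasDerivAt.eventually_ne (c := 0) hd
    exact this
  have hfin : ∀ᶠ w in 𝓝[≠] z, schwarzianFinite g w = schwarzianFinite g⁻¹ w := by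
    filter_upwards [hne0, hev.filter_mono nhdsWithin_le_nhds] with w h1 h2
    have := schwarzianFinite_inv h2.1 h2.2 h1
    rwa [inv_inv] at this
  have hSa := ha.schwarzianFinite hd
  refine ⟨ha, hgz, hd, ?_⟩
  have hz' : schwarzian f z = schwarzianFinite g⁻¹ z := by
    simp only [schwarzian, if_pos hz]
    refine Tendsto.limUnder_eq ?_
    exact (hSa.continuousAt.tendsto.mono_left nhdsWithin_le_nhds).congr' (hfin.mono fun w h => h.symm)
  have : ∀ᶠ w in 𝓝[≠] z, schwarzian f w = schwarzianFinite g⁻¹ w := by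
    filter_upwards [hne0, hfin] with w h1 h2
    have : f w ≠ OnePoint.infty := fun e => h1 (by simp only [hg, Pi.inv_apply, e]; exact inv_zero)
    simp only [schwarzian, if_neg this]
    exact h2
  rw [eventually_nhdsWithin_iff] at this
  filter_upwards [this] with w hw
  by_cases e : w = z
  · rw [e, hz']
  · exact hw e

theorem isLocalCoordinateWith_coordFinite {f : ℂ → OnePoint ℂ} {U : Set ℂ}
    (hf : HolomorphicOn f U) (hinj : LocallyInjectiveOn f U) {z : ℂ} (hz : z ∈ U) :
    IsLocalCoordinateWith (fun w => coordFinite (f w)) (schwarzian f) z := by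
  obtain ⟨V, hV, hi⟩ := hinj z hz
  by_cases h : f z = OnePoint.infty
  · exact .inr (isLocalCoordinateWith_of_eq_infty (hf z hz) hV hi h)
  · exact .inl (isLocalCoordinateWith_of_ne_infty (hf z hz) hV hi h)

/-! ### Regular singular points: polynomial growth and meromorphy. -/

theorem eventually_mem_puncturedDisc : ∀ᶠ z in 𝓝[≠] (0 : ℂ), z ∈ puncturedDisc := by
  have : Metric.ball (0 : ℂ) 1 ∈ 𝓝[≠] (0 : ℂ) :=
    mem_nhdsWithin_of_mem_nhds (Metric.ball_mem_nhds _ one_pos)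
  filter_upwards [this, self_mem_nhdsWithin] with z hz hz0
  exact ⟨norm_pos_iff.2 hz0, by simpa using hz⟩

/-- Solutions of `y''' + 2 S y' + S' y = 0` on the punctured disc grow at most polynomially at a
pole of `S` of order at most two, hence are meromorphic there. -/
theorem meromorphicAt_zero_of_third_order_equation {y S : ℂ → ℂ}
    (hy : ∀ z ∈ puncturedDisc, AnalyticAt ℂ y z)
    (hw : ∀ z ∈ puncturedDisc,
      HasDerivAt (fun w => deriv (deriv y) w + S w * y w) (-S z * deriv y z) z)
    {M : ℝ} (hM : ∀ᶠ z in 𝓝[≠] (0 : ℂ), ‖z ^ 2 * S z‖ ≤ M) : MeromorphicAt y 0 := by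
  obtain ⟨r, hr, hrM⟩ := Metric.mem_nhdsWithin_iff.1 hM
  set ρ : ℝ := min (r / 2) (1 / 2) with hρ
  have hρ0 : 0 < ρ := by positivity
  have hρr : ρ < r := (min_le_left _ _).trans_lt (by linarith)
  have hρ1 : ρ < 1 := (min_le_right _ _).trans_lt (by norm_num)
  have hbd : ∀ z : ℂ, z ≠ 0 → ‖z‖ ≤ ρ → ‖z ^ 2 * S z‖ ≤ M := fun z h0 hz =>
    hrM ⟨by simpa using hz.trans_lt hρr, h0⟩
  have hmem : ∀ z : ℂ, z ≠ 0 → ‖z‖ ≤ ρ → z ∈ puncturedDisc := fun z h0 hz =>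
    ⟨norm_pos_iff.2 h0, hz.trans_lt hρ1⟩
  set W : ℂ → ℂ := fun w => deriv (deriv y) w + S w * y w with hW
  -- These powers of `z` turn the equation into a first-order system `z Y' = B(z) Y` with `B`
  -- bounded near `0`.
  set Y : ℂ → ℂ × ℂ × ℂ := fun z => (y z, z * deriv y z, z ^ 2 * W z) with hY
  set Y' : ℂ → ℂ × ℂ × ℂ := fun z => (deriv y z, 1 * deriv y z + z * deriv (deriv y) z,
    (2 * z) * W z + z ^ 2 * (-S z * deriv y z)) with hY'
  have hYd : ∀ z ∈ puncturedDisc, HasDerivAt Y (Y' z) z := fun z hz => by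
    have h1 := (hy z hz).differentiableAt.hasDerivAt
    have h2 := (hasDerivAt_id z).mul (hy z hz).deriv.differentiableAt.hasDerivAt
    have h3 := ((hasDerivAt_id z).pow 2).mul (hw z hz)
    refine h1.prodMk (h2.prodMk (h3.congr_deriv ?_))
    simp [hW]
  obtain ⟨C, hC⟩ : ∃ C, ∀ z ∈ Metric.sphere (0 : ℂ) ρ, ‖Y z‖ ≤ C := by
    refine (isCompact_sphere (0 : ℂ) ρ).exists_bound_of_continuousOn fun z hz => ?_
    have hz' : ‖z‖ = ρ := by simpa using hz
    have h0 : z ≠ 0 := norm_pos_iff.1 (by rw [hz']; exact hρ0)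
    exact (hYd z (hmem z h0 hz'.le)).continuousAt.continuousWithinAt
  -- In the sup norm the three rows of `B` are bounded by `1`, `M + 2` and `M + 2`.
  obtain ⟨N, hN⟩ := exists_nat_ge (2 + M)
  have hM0 : 0 ≤ M := (norm_nonneg _).trans
    (hbd (ρ : ℂ) (by exact_mod_cast hρ0.ne') (by simp [abs_of_pos hρ0]))
  have hYb : ∀ z : ℂ, z ≠ 0 → ‖z‖ ≤ ρ → ‖(-z) • Y' z‖ ≤ N * ‖Y z‖ + 0 := by
    intro z h0 hz
    have b1 : ‖y z‖ ≤ ‖Y z‖ := norm_fst_le (Y z)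
    have b2 : ‖z * deriv y z‖ ≤ ‖Y z‖ := (norm_fst_le (Y z).2).trans (norm_snd_le (Y z))
    have b3 : ‖z ^ 2 * W z‖ ≤ ‖Y z‖ := (norm_snd_le (Y z).2).trans (norm_snd_le (Y z))
    have hS := hbd z h0 hz
    have hYn := norm_nonneg (Y z)
    have hle : (2 + M) * ‖Y z‖ ≤ N * ‖Y z‖ := mul_le_mul_of_nonneg_right hN hYn
    have hMY := mul_nonneg hM0 hYn
    rw [add_zero]
    refine le_trans ?_ hle
    simp only [hY', Prod.smul_mk, smul_eq_mul]
    refine norm_prod_le_iff.2 ⟨?_, norm_prod_le_iff.2 ⟨?_, ?_⟩⟩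
    · show ‖-z * deriv y z‖ ≤ _
      rw [neg_mul, norm_neg]
      linarith
    · show ‖-z * (1 * deriv y z + z * deriv (deriv y) z)‖ ≤ _
      have : -z * (1 * deriv y z + z * deriv (deriv y) z)
          = (z ^ 2 * S z) * y z - z * deriv y z - z ^ 2 * W z := by simp only [hW]; ring
      rw [this]
      have := (norm_sub_le ((z ^ 2 * S z) * y z - z * deriv y z) (z ^ 2 * W z))
      have := norm_sub_le ((z ^ 2 * S z) * y z) (z * deriv y z)
      have : ‖(z ^ 2 * S z) * y z‖ ≤ M * ‖Y z‖ := by rw [norm_mul]; gcongr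
      linarith
    · show ‖-z * ((2 * z) * W z + z ^ 2 * (-S z * deriv y z))‖ ≤ _
      have : -z * ((2 * z) * W z + z ^ 2 * (-S z * deriv y z))
          = (z ^ 2 * S z) * (z * deriv y z) - z ^ 2 * W z - z ^ 2 * W z := by ring
      rw [this]
      have := (norm_sub_le ((z ^ 2 * S z) * (z * deriv y z) - z ^ 2 * W z) (z ^ 2 * W z))
      have := norm_sub_le ((z ^ 2 * S z) * (z * deriv y z)) (z ^ 2 * W z)
      have : ‖(z ^ 2 * S z) * (z * deriv y z)‖ ≤ M * ‖Y z‖ := by rw [norm_mul]; gcongr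
      linarith
  have growth : ∀ z : ℂ, z ≠ 0 → ‖z‖ ≤ ρ → ‖y z‖ ≤ C * (ρ / ‖z‖) ^ N := by
    intro z h0 hz
    have hzp : 0 < ‖z‖ := norm_pos_iff.2 h0
    set T := Real.log (ρ / ‖z‖) with hT
    have hT0 : 0 ≤ T := Real.log_nonneg ((one_le_div hzp).2 hz)
    have hTe : Real.exp T = ρ / ‖z‖ := Real.exp_log (by positivity)
    -- Radial path in logarithmic time, from the circle of radius `ρ` at `t = 0` to `z` at `t = T`.
    -- Since `γ' = -γ`, the factor `exp (N T)` from Grönwall is `(ρ / ‖z‖) ^ N`.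
    set γ : ℝ → ℂ := fun t => z * ((Real.exp (T - t) : ℝ) : ℂ) with hγ
    have hγd : ∀ t, HasDerivAt γ (-γ t) t := by
      intro t
      have := (((hasDerivAt_id t).const_sub T).exp.ofReal_comp).const_mul z
      refine this.congr_deriv ?_
      simp [hγ]
    have hγ0 : ∀ t, γ t ≠ 0 := fun t =>
      mul_ne_zero h0 (by exact_mod_cast (Real.exp_pos _).ne')
    have hγn : ∀ t, ‖γ t‖ = ‖z‖ * Real.exp (T - t) := fun t => by
      simp only [hγ, norm_mul, Complex.norm_real, Real.norm_of_nonneg (Real.exp_pos _).le]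
    have hγle : ∀ t, 0 ≤ t → ‖γ t‖ ≤ ρ := fun t ht => by
      rw [hγn]
      calc ‖z‖ * Real.exp (T - t) ≤ ‖z‖ * Real.exp T := by gcongr; linarith
        _ = ρ := by rw [hTe]; field_simp
    have hcomp : ∀ t, 0 ≤ t → HasDerivAt (fun t => Y (γ t)) ((-γ t) • Y' (γ t)) t := fun t ht =>
      HasDerivAt.scomp t (hYd _ (hmem _ (hγ0 t) (hγle t ht))) (hγd t)
    have := norm_le_gronwallBound_of_norm_deriv_right_le (f := fun t => Y (γ t))
      (f' := fun t => (-γ t) • Y' (γ t)) (δ := C) (K := N) (ε := 0) (a := 0) (b := T)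
      (fun t ht => (hcomp t ht.1).continuousAt.continuousWithinAt)
      (fun t ht => (hcomp t ht.1).hasDerivWithinAt)
      (hC _ (by
        rw [mem_sphere_zero_iff_norm, hγn, sub_zero, hTe]; field_simp))
      (fun t ht => hYb _ (hγ0 t) (hγle t ht.1)) T ⟨hT0, le_rfl⟩
    rw [gronwallBound_ε0, sub_zero, Real.exp_nat_mul, hTe] at this
    have hγT : γ T = z := by simp [hγ]
    simp only [hγT] at this
    exact (norm_fst_le (Y z)).trans this
  -- The exponent exceeds the growth rate by one, so the product tends to its value `0` at the
  -- origin and the singularity is removable.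
  refine ⟨N + 1, ?_⟩
  have hzero : ((0 : ℂ) - 0) ^ (N + 1) • y 0 = 0 := by simp
  have hsmall : ∀ᶠ z in 𝓝[≠] (0 : ℂ), z ≠ 0 ∧ ‖z‖ ≤ ρ := by
    have : Metric.closedBall (0 : ℂ) ρ ∈ 𝓝[≠] (0 : ℂ) :=
      mem_nhdsWithin_of_mem_nhds (Metric.closedBall_mem_nhds _ hρ0)
    filter_upwards [this, self_mem_nhdsWithin] with z h1 h2
    exact ⟨h2, by simpa using h1⟩
  apply Complex.analyticAt_of_differentiable_on_punctured_nhds_of_continuousAt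
  · filter_upwards [hsmall] with z hz
    exact (((differentiableAt_id.sub_const 0).pow (N + 1)).smul
      (hy z (hmem z hz.1 hz.2)).differentiableAt)
  · rw [continuousAt_iff_punctured_nhds, hzero]
    have hlim : Tendsto (fun z : ℂ => C * ρ ^ N * ‖z‖) (𝓝[≠] 0) (𝓝 0) := by
      have : Continuous fun z : ℂ => C * ρ ^ N * ‖z‖ := by fun_prop
      have := this.tendsto 0
      simp only [norm_zero, mul_zero] at this
      exact this.mono_left nhdsWithin_le_nhds
    refine squeeze_zero_norm' ?_ hlim
    filter_upwards [hsmall] with z hz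
    have hzp : 0 < ‖z‖ := norm_pos_iff.2 hz.1
    rw [sub_zero, norm_smul, norm_pow]
    calc ‖z‖ ^ (N + 1) * ‖y z‖ ≤ ‖z‖ ^ (N + 1) * (C * (ρ / ‖z‖) ^ N) := by
          gcongr; exact growth z hz.1 hz.2
      _ = C * ρ ^ N * ‖z‖ := by rw [div_pow, pow_succ]; field_simp

/-- Near `z` the product `g * g⁻¹` is `1` off `z` but `0` at `z`. Thus the default value at a pole
makes `g` discontinuous, which gives `deriv g z = 0` there and lets analyticity of `g` rule out
poles. -/
theorem not_continuousAt_of_inv {g : ℂ → ℂ} {z : ℂ} (ha : AnalyticAt ℂ g⁻¹ z) (hz : g z = 0)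
    (hd : deriv g⁻¹ z ≠ 0) : ¬ ContinuousAt g z := by
  intro hc
  have hnc : ∀ᶠ w in 𝓝[≠] z, g⁻¹ w ≠ 0 :=
    ha.differentiableAt.hasDerivAt.eventually_ne (c := 0) hd
  have h1 : Tendsto (fun w => g w * g⁻¹ w) (𝓝[≠] z) (𝓝 (g z * g⁻¹ z)) :=
    (hc.mul ha.continuousAt).tendsto.mono_left nhdsWithin_le_nhds
  have h2 : Tendsto (fun w => g w * g⁻¹ w) (𝓝[≠] z) (𝓝 1) := by
    refine tendsto_const_nhds.congr' ?_
    filter_upwards [hnc] with w hw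
    exact (mul_inv_cancel₀ (fun h => hw (by simp [h]))).symm
  have := tendsto_nhds_unique h1 h2
  simp [hz] at this

/-- At a pole of `g`, put `h = 1 / g`: then `1 / g' = -h² / h'` and `g / g' = -h / h'`, again
quadratics in `h` over `h'`. -/
theorem IsLocalCoordinateWith.third_order_equation {g S : ℂ → ℂ} {z : ℂ}
    (h : IsLocalCoordinateWith g S z) :
    (AnalyticAt ℂ (deriv g)⁻¹ z ∧ HasDerivAt
      (fun w => deriv (deriv (deriv g)⁻¹) w + S w * (deriv g)⁻¹ w) (-S z * deriv (deriv g)⁻¹ z) z) ∧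
    (AnalyticAt ℂ (g * (deriv g)⁻¹) z ∧ HasDerivAt
      (fun w => deriv (deriv (g * (deriv g)⁻¹)) w + S w * (g * (deriv g)⁻¹) w)
        (-S z * deriv (g * (deriv g)⁻¹) z) z) := by
  rcases h with ⟨ha, hd, hS⟩ | ⟨ha, hz, hd, hS⟩
  · refine ⟨hasDerivAt_of_quadratic_div_deriv 1 0 0 ha hd hS ?_,
      hasDerivAt_of_quadratic_div_deriv 0 1 0 ha hd hS ?_⟩
    · exact Eventually.of_forall fun w => by simp
    · exact Eventually.of_forall fun w => by simp [div_eq_mul_inv]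
  · have hnc : ∀ᶠ w in 𝓝[≠] z, g⁻¹ w ≠ 0 :=
      ha.differentiableAt.hasDerivAt.eventually_ne (c := 0) hd
    have hdg : ∀ᶠ w in 𝓝 z, (deriv g)⁻¹ w = -(g⁻¹ w) ^ 2 / deriv g⁻¹ w := by
      -- The formula for `1 / g'` must hold at the pole itself too: both sides are `0`, the left one
      -- by default values.
      have hgz : deriv g z = 0 := deriv_zero_of_not_differentiableAt fun hc =>
        not_continuousAt_of_inv ha hz hd hc.continuousAt
      rw [eventually_nhdsWithin_iff] at hnc
      filter_upwards [hnc, ha.eventually_analyticAt] with w hw haw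
      by_cases e : w = z
      · simp [e, hgz, hz]
      · have h1 := (haw.differentiableAt.hasDerivAt.inv (hw e)).deriv
        rw [inv_inv] at h1
        rw [Pi.inv_apply, h1, inv_div, div_neg, neg_div]
    refine ⟨hasDerivAt_of_quadratic_div_deriv 0 0 (-1) ha hd hS ?_,
      hasDerivAt_of_quadratic_div_deriv 0 (-1) 0 ha hd hS ?_⟩
    · filter_upwards [hdg] with w hw
      rw [hw]; ring
    · filter_upwards [hdg] with w hw
      rw [Pi.mul_apply, hw, Pi.inv_apply]
      by_cases h0 : g w = 0
      · simp [h0]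
      · field_simp; ring

/-- `g` is the quotient of the solutions `g / g'` and `1 / g'`; at a pole both sides take the
default value `0`. -/
theorem meromorphicAt_zero_of_isLocalCoordinateWith {g S : ℂ → ℂ}
    (h : ∀ z ∈ puncturedDisc, IsLocalCoordinateWith g S z)
    {M : ℝ} (hM : ∀ᶠ z in 𝓝[≠] (0 : ℂ), ‖z ^ 2 * S z‖ ≤ M) : MeromorphicAt g 0 := by
  have hp : MeromorphicAt (deriv g)⁻¹ 0 := meromorphicAt_zero_of_third_order_equation
    (fun z hz => (h z hz).third_order_equation.1.1)
    (fun z hz => (h z hz).third_order_equation.1.2) hM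
  have hq : MeromorphicAt (g * (deriv g)⁻¹) 0 := meromorphicAt_zero_of_third_order_equation
    (fun z hz => (h z hz).third_order_equation.2.1)
    (fun z hz => (h z hz).third_order_equation.2.2) hM
  refine (hq.mul hp.inv).congr ?_
  filter_upwards [eventually_mem_puncturedDisc] with z hz
  rcases h z hz with ⟨-, hd, -⟩ | ⟨-, h0, -⟩
  · simp [hd]
  · simp [h0]

/-! ### Taylor coefficients and the determinant. -/

/-- The `n`-th Taylor coefficient at the origin. -/
noncomputable def taylorCoeff (f : ℂ → ℂ) (n : ℕ) : ℂ := iteratedDeriv n f 0 / n.factorial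

theorem taylorCoeff_zero (f : ℂ → ℂ) : taylorCoeff f 0 = f 0 := by simp [taylorCoeff]

theorem taylorCoeff_congr {f g : ℂ → ℂ} (h : f =ᶠ[𝓝 0] g) (n : ℕ) :
    taylorCoeff f n = taylorCoeff g n := by
  rw [taylorCoeff, taylorCoeff, h.iteratedDeriv_eq]

theorem taylorCoeff_mul {f g : ℂ → ℂ} (hf : AnalyticAt ℂ f 0) (hg : AnalyticAt ℂ g 0) (n : ℕ) :
    taylorCoeff (fun z => f z * g z) n =
      ∑ i ∈ Finset.range (n + 1), taylorCoeff f i * taylorCoeff g (n - i) := by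
  have := iteratedDeriv_fun_mul (n := n) (hf.contDiffAt) (hg.contDiffAt)
  simp only [taylorCoeff]
  rw [this, Finset.sum_div]
  refine Finset.sum_congr rfl fun i hi => ?_
  have hi' : i ≤ n := Nat.lt_succ_iff.1 (Finset.mem_range.1 hi)
  rw [Nat.cast_choose ℂ hi']
  have h1 := Nat.factorial_ne_zero n
  have h2 := Nat.factorial_ne_zero i
  have h3 := Nat.factorial_ne_zero (n - i)
  field_simp

theorem taylorCoeff_deriv (f : ℂ → ℂ) (n : ℕ) :
    taylorCoeff (deriv f) n = (n + 1) * taylorCoeff f (n + 1) := by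
  simp only [taylorCoeff, iteratedDeriv_succ', Nat.factorial_succ]
  have h1 := Nat.factorial_ne_zero n
  have : (n : ℂ) + 1 ≠ 0 := by exact_mod_cast n.succ_ne_zero
  push_cast
  field_simp

theorem taylorCoeff_id_mul {f : ℂ → ℂ} (hf : AnalyticAt ℂ f 0) (n : ℕ) :
    taylorCoeff (fun z => z * f z) (n + 1) = taylorCoeff f n := by
  rw [taylorCoeff_mul (f := fun z => z) analyticAt_id hf, Finset.sum_eq_single 1]
  · simp [taylorCoeff, iteratedDeriv_one]
  · intro i _ hi
    rcases i with _ | _ | i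
    · simp [taylorCoeff]
    · exact absurd rfl hi
    · have : deriv (fun z : ℂ => z) = fun _ => 1 := by ext; simp
      simp [taylorCoeff, iteratedDeriv_succ', this, deriv_const']
  · intro h
    simp at h

/-- The Euler operator `z d/dz` multiplies the `n`-th Taylor coefficient by `n`. -/
theorem taylorCoeff_euler {f : ℂ → ℂ} (hf : AnalyticAt ℂ f 0) (n : ℕ) :
    taylorCoeff (fun z => z * deriv f z) n = n * taylorCoeff f n := by
  rcases n with _ | n
  · simp [taylorCoeff]
  · rw [taylorCoeff_id_mul hf.deriv, taylorCoeff_deriv]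
    push_cast; rfl

theorem AnalyticAt.eventually_hasSum_taylorCoeff {f : ℂ → ℂ} (hf : AnalyticAt ℂ f 0) :
    ∀ᶠ z in 𝓝 0, HasSum (fun n => taylorCoeff f n * z ^ n) (f z) := by
  filter_upwards [hasFPowerSeriesAt_iff'.1 hf.hasFPowerSeriesAt] with z hz
  refine hz.congr_fun fun n => ?_
  simp [taylorCoeff, mul_comm]

/-- The recursion between the Taylor coefficients of `A` and `v` forces the determinant to vanish. -/
theorem det_coefficientMatrix_eq_zero {d : ℕ} (hd : 1 ≤ d) {a c : ℕ → ℂ} (hc : c 0 ≠ 0)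
    (h : ∀ n : ℕ, ∑ i ∈ Finset.range (n + 1), a i * c (n - i) =
      (a 0 - 2 * (n : ℂ) * (n - d)) * c n) :
    (coefficientMatrix d a).det = 0 := by
  -- Row `i` applied to `(c 0, …, c (d-1))` is the recursion at `n = i + 1`. In the last row `n =
  -- d`, so the factor `n - d` removes the missing entry `c d`.
  refine Matrix.exists_mulVec_eq_zero_iff.1 ⟨fun j => c j, ?_, ?_⟩
  · intro e
    exact hc (congrFun e ⟨0, hd⟩)
  ext i
  obtain ⟨i, hi⟩ := i
  have hrec := h (i + 1)
  rw [Finset.sum_range_succ', ← Finset.sum_range_reflect] at hrec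
  simp only [Matrix.mulVec, dotProduct, coefficientMatrix, Matrix.of_apply, Pi.zero_apply]
  rw [Fin.sum_univ_eq_sum_range (fun j => (if j ≤ i then a (i - j + 1)
    else if j = i + 1 then 2 * (j : ℂ) * ((j : ℂ) - (d : ℂ)) else 0) * c j) d]
  have hlow : ∑ j ∈ Finset.range (i + 1), (if j ≤ i then a (i - j + 1)
      else if j = i + 1 then 2 * (j : ℂ) * ((j : ℂ) - (d : ℂ)) else 0) * c j =
      ∑ j ∈ Finset.range (i + 1), a (i + 1 - 1 - j + 1) * c (i + 1 - (i + 1 - 1 - j + 1)) := by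
    refine Finset.sum_congr rfl fun j hj => ?_
    have hj' : j ≤ i := Nat.lt_succ_iff.1 (Finset.mem_range.1 hj)
    rw [if_pos hj', show i + 1 - (i + 1 - 1 - j + 1) = j by omega,
      show i + 1 - 1 - j + 1 = i - j + 1 by omega]
  have hsum : ∑ j ∈ Finset.range d, (if j ≤ i then a (i - j + 1)
      else if j = i + 1 then 2 * (j : ℂ) * ((j : ℂ) - (d : ℂ)) else 0) * c j =
      ∑ j ∈ Finset.range (i + 1), a (i + 1 - 1 - j + 1) * c (i + 1 - (i + 1 - 1 - j + 1)) +
        2 * ((i + 1 : ℕ) : ℂ) * (((i + 1 : ℕ) : ℂ) - d) * c (i + 1) := by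
    rcases (Nat.succ_le_of_lt hi).eq_or_lt with e | hlt
    · rw [← hlow, ← e]
      simp
    · have hzero : ∀ j ∈ Finset.Ico (i.succ + 1) d, (if j ≤ i then a (i - j + 1)
          else if j = i + 1 then 2 * (j : ℂ) * ((j : ℂ) - (d : ℂ)) else 0) * c j = 0 := by
        intro j hj
        rw [Finset.mem_Ico] at hj
        rw [if_neg (by omega), if_neg (by omega), zero_mul]
      rw [← hlow, ← Finset.sum_range_add_sum_Ico _ hlt.le,
        Finset.sum_eq_sum_Ico_succ_bot hlt, Finset.sum_eq_zero hzero, add_zero,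
        if_neg (by omega), if_pos rfl]
  rw [hsum]
  simp only [Nat.sub_zero] at hrec
  linear_combination hrec

/-! ### Expansion of the Schwarzian at a critical point. -/

/-- Local form of the Schwarzian derivative of an analytic function at an isolated critical
point. -/
theorem exists_schwarzianFinite_expansion {H : ℂ → ℂ} (hH : AnalyticAt ℂ H 0)
    (hne : ∀ᶠ z in 𝓝[≠] (0 : ℂ), deriv H z ≠ 0) :
    ∃ d : ℕ, 1 ≤ d ∧ (d = 1 → deriv H 0 ≠ 0) ∧ (2 ≤ d → deriv H 0 = 0) ∧
      ∃ A : ℂ → ℂ, AnalyticAt ℂ A 0 ∧ A 0 = (1 - (d : ℂ) ^ 2) / 2 ∧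
        (∀ᶠ z in 𝓝[≠] (0 : ℂ), z ^ 2 * schwarzianFinite H z = A z) ∧
        (coefficientMatrix d (taylorCoeff A)).det = 0 := by
  have htop : analyticOrderAt (deriv H) 0 ≠ ⊤ := by
    intro ht
    rw [analyticOrderAt_eq_top] at ht
    obtain ⟨z, h1, h2⟩ := (hne.and (ht.filter_mono nhdsWithin_le_nhds)).exists
    exact h1 h2
  obtain ⟨h, hh, h0, he⟩ := hH.deriv.analyticOrderAt_ne_top.1 htop
  set m := analyticOrderNatAt (deriv H) 0 with hm
  have hH0 : deriv H 0 = 0 ^ m * h 0 := by simpa using he.self_of_nhds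
  -- Here `v² = 1 / h`, so `H' = z^m / v²`. Formally `z^(-m/2) v = (H')^(-1/2)` solves `u'' + S u /
  -- 2 = 0`; working with `v` avoids half-integer powers.
  obtain ⟨v, hv, hv0, hvp⟩ := (hh.inv h0).exists_pow_eventuallyEq (inv_ne_zero h0) two_ne_zero
  set d : ℕ := m + 1 with hd
  set θv : ℂ → ℂ := fun z => z * deriv v z with hθ
  set θθv : ℂ → ℂ := fun z => z * deriv θv z with hθθ
  have hθa : AnalyticAt ℂ θv 0 := analyticAt_id.mul hv.deriv
  have hθθa : AnalyticAt ℂ θθv 0 := analyticAt_id.mul hθa.deriv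
  set α : ℂ := (1 - (d : ℂ) ^ 2) / 2 with hα
  -- This is `-2 z² u'' / u` for `u = z^(-m/2) v`, since `z² u'' = θ(θ - 1)u` and `θ` acts on `v` as
  -- `θ - m/2`.
  set A : ℂ → ℂ := fun z => α + (-2 * θθv z + 2 * d * θv z) / v z with hA
  have hAa : AnalyticAt ℂ A 0 := analyticAt_const.add
    (((analyticAt_const.mul hθθa).add (analyticAt_const.mul hθa)).div hv hv0)
  have hA0 : A 0 = α := by simp [hA, hθ, hθθ]
  refine ⟨d, by omega, ?_, ?_, A, hAa, hA0, ?_, ?_⟩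
  · intro e
    have : m = 0 := by omega
    rw [hH0, this]; simpa using h0
  · intro e
    rw [hH0, zero_pow (by omega), zero_mul]
  · have hloc : ∀ᶠ z in 𝓝 (0 : ℂ), (deriv H z * v z ^ 2 = z ^ m) ∧ AnalyticAt ℂ v z ∧ v z ≠ 0 ∧
        AnalyticAt ℂ H z := by
      filter_upwards [he, hvp, hh.continuousAt.eventually_ne h0, hv.eventually_analyticAt,
        hv.continuousAt.eventually_ne hv0, hH.eventually_analyticAt] with z h1 h2 h3 h4 h5 h6
      refine ⟨?_, h4, h5, h6⟩
      rw [h1, h2, Pi.inv_apply, smul_eq_mul, sub_zero]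
      field_simp
    have hN : ∀ z, (∀ᶠ w in 𝓝 z, (deriv H w * v w ^ 2 = w ^ m) ∧ AnalyticAt ℂ v w ∧ v w ≠ 0 ∧
        AnalyticAt ℂ H w) → deriv H z ≠ 0 → z ≠ 0 →
        deriv (deriv H) z / deriv H z = m / z - 2 * (deriv v z / v z) := by
      intro z hz hHz hz0
      obtain ⟨h1, h2, h3, h4⟩ := hz.self_of_nhds
      have e1 : deriv (fun w => deriv H w * v w ^ 2) z = _ :=
        (h4.deriv.differentiableAt.hasDerivAt.mul (h2.differentiableAt.hasDerivAt.pow 2)).deriv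
      have e2 : deriv (fun w : ℂ => w ^ m) z = _ := (hasDerivAt_pow m z).deriv
      have e3 : deriv (fun w => deriv H w * v w ^ 2) z = deriv (fun w : ℂ => w ^ m) z :=
        Filter.EventuallyEq.deriv_eq (hz.mono fun w hw => hw.1)
      have e4 : (m : ℂ) * z ^ (m - 1) * z = m * z ^ m := by
        rcases m with _ | m
        · simp
        · simp [pow_succ, mul_assoc]
      rw [e1, e2] at e3
      simp only [Pi.pow_apply] at e3
      field_simp
      have : v z * (deriv (deriv H) z * z * v z - deriv H z * (m * v z - z * 2 * deriv v z)) = 0 := by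
        linear_combination z * e3 + e4 - m * h1
      have := (mul_eq_zero.1 this).resolve_left h3
      linear_combination this
    filter_upwards [hloc.eventually_nhds.filter_mono nhdsWithin_le_nhds, eventually_nhdsNE_eventually_nhds_iff.2 hne,
      self_mem_nhdsWithin] with z hz hHz hz0
    have hz0' : z ≠ 0 := hz0
    obtain ⟨h1, h2, h3, h4⟩ := hz.self_of_nhds
    have hHz0 : deriv H z ≠ 0 := mem_of_mem_nhds hHz
    have e : (fun w => deriv (deriv H) w / deriv H w) =ᶠ[𝓝 z]
        fun w => m / w - 2 * (deriv v w / v w) := by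
      filter_upwards [hz.eventually_nhds, hHz, eventually_ne_nhds hz0'] with w hw1 hw2 hw3
      exact hN w hw1 hw2 hw3
    have e1 : deriv (fun w => (m : ℂ) / w - 2 * (deriv v w / v w)) z = _ :=
      ((((hasDerivAt_const z (m : ℂ)).div (hasDerivAt_id z) hz0')).sub
        ((h2.deriv.differentiableAt.hasDerivAt.div h2.differentiableAt.hasDerivAt h3).const_mul
          2)).deriv
    have e2 : deriv θv z = _ :=
      ((hasDerivAt_id z).mul h2.deriv.differentiableAt.hasDerivAt).deriv
    rw [schwarzianFinite_eq_preSchwarzian h4 hHz0, e.deriv_eq, e1,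
      hN z hz hHz0 hz0']
    simp only [hA, hθθ, e2]
    simp only [hθ, hα, hd]
    push_cast
    simp only [id]
    field_simp
    ring
  · have hrel : (fun z => A z * v z) =ᶠ[𝓝 0] fun z => α * v z + (-2 * θθv z + 2 * d * θv z) := by
      filter_upwards [hv.continuousAt.eventually_ne hv0] with z hz
      simp only [hA]
      field_simp
    refine det_coefficientMatrix_eq_zero (c := taylorCoeff v) (by omega)
      (by rwa [taylorCoeff_zero]) fun n => ?_
    rw [← taylorCoeff_mul hAa hv, taylorCoeff_congr hrel, taylorCoeff_zero, hA0]
    have t1 : taylorCoeff θv n = n * taylorCoeff v n := taylorCoeff_euler hv n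
    have t2 : taylorCoeff θθv n = n * taylorCoeff θv n := taylorCoeff_euler hθa n
    have : taylorCoeff (fun z => α * v z + (-2 * θθv z + 2 * d * θv z)) n =
        α * taylorCoeff v n + (-2 * taylorCoeff θθv n + 2 * d * taylorCoeff θv n) := by
      have c1 : ContDiffAt ℂ n v 0 := hv.contDiffAt
      have c2 : ContDiffAt ℂ n θv 0 := hθa.contDiffAt
      have c3 : ContDiffAt ℂ n θθv 0 := hθθa.contDiffAt
      simp only [taylorCoeff]
      rw [iteratedDeriv_fun_add (contDiffAt_const.mul c1)
        ((contDiffAt_const.mul c3).add (contDiffAt_const.mul c2)),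
        iteratedDeriv_fun_add (contDiffAt_const.mul c3) (contDiffAt_const.mul c2),
        iteratedDeriv_const_mul_field, iteratedDeriv_const_mul_field, iteratedDeriv_const_mul_field]
      ring
    rw [this, t2, t1]
    ring

/-! ### Extension across the puncture. -/

theorem RiemannSphere.HolomorphicAt.congr {f F : ℂ → OnePoint ℂ} {z : ℂ} (hf : HolomorphicAt f z)
    (h : F =ᶠ[𝓝 z] f) : HolomorphicAt F z := by
  refine ⟨hf.1.congr h.symm, fun hz => ?_, fun hz => ?_⟩
  · exact (hf.2.1 (h.self_of_nhds ▸ hz)).congr (h.symm.mono fun w hw => congrArg coordFinite hw)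
  · exact (hf.2.2 (h.self_of_nhds ▸ hz)).congr (h.symm.mono fun w hw => congrArg coordInfty hw)

theorem holomorphicOn_update {f : ℂ → OnePoint ℂ} (hf : HolomorphicOn f puncturedDisc)
    {p : OnePoint ℂ} (h0 : HolomorphicAt (Function.update f 0 p) 0) :
    HolomorphicOn (Function.update f 0 p) (Metric.ball 0 1) := by
  intro z hz
  by_cases e : z = 0
  · rw [e]; exact h0
  · refine (hf z ⟨norm_pos_iff.2 e, by simpa using hz⟩).congr ?_
    filter_upwards [eventually_ne_nhds e] with w hw
    exact Function.update_of_ne hw _ _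

/-- A locally injective map whose affine coordinate is meromorphic at the origin extends
holomorphically, and its Schwarzian derivative is that of a local coordinate of the extension. -/
theorem exists_holomorphic_extension {f : ℂ → OnePoint ℂ}
    (hf : HolomorphicOn f puncturedDisc) (hinj : LocallyInjectiveOn f puncturedDisc)
    (hg : MeromorphicAt (fun w => coordFinite (f w)) 0) :
    ∃ (F : ℂ → OnePoint ℂ) (H : ℂ → ℂ), EqOn F f puncturedDisc ∧
      HolomorphicOn F (Metric.ball 0 1) ∧ AnalyticAt ℂ H 0 ∧
      (∀ᶠ z in 𝓝[≠] (0 : ℂ), deriv H z ≠ 0) ∧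
      (∀ᶠ z in 𝓝[≠] (0 : ℂ), schwarzian f z = schwarzianFinite H z) ∧
      (deriv H 0 = 0 → IsCriticalPoint F 0) := by
  set g : ℂ → ℂ := fun w => coordFinite (f w) with hgdef
  have hev : ∀ᶠ z in 𝓝[≠] (0 : ℂ), z ≠ 0 ∧ f z ≠ OnePoint.infty ∧ AnalyticAt ℂ g z ∧
      deriv g z ≠ 0 ∧ schwarzian f z = schwarzianFinite g z := by
    filter_upwards [eventually_mem_puncturedDisc, hg.eventually_analyticAt,
      self_mem_nhdsWithin] with z hz hga hz0
    obtain ⟨V, hV, hi⟩ := hinj z hz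
    -- A meromorphic `g` is analytic at all nearby points, so poles of `f` cannot accumulate at the
    -- origin.
    have hfin : f z ≠ OnePoint.infty := fun e => by
      obtain ⟨h1, h2, h3, -⟩ := isLocalCoordinateWith_of_eq_infty (hf z hz) hV hi e
      exact not_continuousAt_of_inv h1 h2 h3 hga.continuousAt
    obtain ⟨h1, h2, h3⟩ := isLocalCoordinateWith_of_ne_infty (hf z hz) hV hi hfin
    exact ⟨hz0, hfin, h1, h2, h3.self_of_nhds⟩
  have heq : ∀ p, EqOn (Function.update f 0 p) f puncturedDisc := fun p z hz =>
    Function.update_of_ne (norm_pos_iff.1 hz.1) _ _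
  by_cases ho : 0 ≤ meromorphicOrderAt g 0
  · obtain ⟨c, hc⟩ := tendsto_nhds_of_meromorphicOrderAt_nonneg hg ho
    set H : ℂ → ℂ := Function.update g 0 c with hH
    have hHz : ∀ z : ℂ, z ≠ 0 → H =ᶠ[𝓝 z] g := fun z hz => by
      filter_upwards [eventually_ne_nhds hz] with w hw
      exact Function.update_of_ne hw _ _
    have hHc : ContinuousAt H 0 := continuousAt_update_same.2 hc
    have hHa : AnalyticAt ℂ H 0 := (hg.update 0 c).analyticAt hHc
    have hcoord : (fun w => coordFinite (Function.update f 0 (c : OnePoint ℂ) w)) = H := by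
      funext w
      by_cases e : w = 0
      · subst e; simp only [hH, Function.update_self]; rfl
      · simp only [hH, Function.update_of_ne e, hgdef]
    have hF0 : Function.update f 0 (c : OnePoint ℂ) 0 ≠ OnePoint.infty := by
      rw [Function.update_self]; exact OnePoint.coe_ne_infty c
    refine ⟨Function.update f 0 (c : OnePoint ℂ), H, heq _, holomorphicOn_update hf ?_, hHa,
      ?_, ?_, fun hd => ⟨fun _ => by rwa [hcoord], fun e => absurd e hF0⟩⟩
    · refine ⟨continuousAt_update_same.2 ?_, fun _ => by rwa [hcoord], fun e => absurd e hF0⟩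
      refine ((OnePoint.continuous_coe.tendsto c).comp hc).congr' ?_
      filter_upwards [hev] with z hz
      exact coe_coordFinite hz.2.1
    · filter_upwards [hev] with z hz
      rw [(hHz z hz.1).deriv_eq]; exact hz.2.2.2.1
    · filter_upwards [hev] with z hz
      rw [schwarzianFinite_congr (hHz z hz.1)]; exact hz.2.2.2.2
  · have hcob := tendsto_cobounded_of_meromorphicOrderAt_neg (not_le.1 ho)
    have hgne : ∀ᶠ z in 𝓝[≠] (0 : ℂ), g z ≠ 0 :=
      hcob.eventually (Bornology.eventually_ne_cobounded 0)
    set H : ℂ → ℂ := Function.update g⁻¹ 0 0 with hH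
    have hHz : ∀ z : ℂ, z ≠ 0 → H =ᶠ[𝓝 z] g⁻¹ := fun z hz => by
      filter_upwards [eventually_ne_nhds hz] with w hw
      exact Function.update_of_ne hw _ _
    have hHc : ContinuousAt H 0 :=
      continuousAt_update_same.2 (tendsto_inv₀_cobounded.comp hcob)
    have hHa : AnalyticAt ℂ H 0 := (hg.inv.update 0 0).analyticAt hHc
    have hcoord : (fun w => coordInfty (Function.update f 0 OnePoint.infty w)) = H := by
      funext w
      by_cases e : w = 0
      · subst e; simp only [hH, Function.update_self]; rfl
      · simp only [hH, Function.update_of_ne e, hgdef, coordInfty_eq_inv, Pi.inv_apply]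
    have hF0 : Function.update f 0 OnePoint.infty 0 = OnePoint.infty := Function.update_self ..
    refine ⟨Function.update f 0 OnePoint.infty, H, heq _, holomorphicOn_update hf ?_, hHa,
      ?_, ?_, fun hd => ⟨fun e => absurd hF0 e, fun _ => by rwa [hcoord]⟩⟩
    · refine ⟨continuousAt_update_same.2 ?_, fun e => absurd hF0 e, fun _ => by rwa [hcoord]⟩
      have hcc : Tendsto g (𝓝[≠] 0) (coclosedCompact ℂ) := by
        rwa [coclosedCompact_eq_cocompact, ← Metric.cobounded_eq_cocompact]
      refine (OnePoint.tendsto_coe_infty.comp hcc).congr' ?_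
      filter_upwards [hev] with z hz
      exact coe_coordFinite hz.2.1
    · filter_upwards [hev, hgne] with z hz hz0
      rw [(hHz z hz.1).deriv_eq, (hz.2.2.1.differentiableAt.hasDerivAt.inv hz0).deriv]
      exact div_ne_zero (neg_ne_zero.2 hz.2.2.2.1) (pow_ne_zero 2 hz0)
    · filter_upwards [hev, hgne] with z hz hz0
      rw [schwarzianFinite_congr (hHz z hz.1), schwarzianFinite_inv hz.2.2.1 hz.2.2.2.1 hz0]
      exact hz.2.2.2.2

/-! ### Order of the pole and conclusion. -/

/-- A function that is not meromorphic has order `0` by convention; `n ≠ 0` therefore supplies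
meromorphy. The bound is the input to the growth estimate. -/
theorem exists_norm_sq_mul_le_of_meromorphicOrderAt {S : ℂ → ℂ} {n : ℤ} (hn : -2 ≤ n) (hn0 : n ≠ 0)
    (h : meromorphicOrderAt S 0 = n) : ∃ M : ℝ, ∀ᶠ z in 𝓝[≠] (0 : ℂ), ‖z ^ 2 * S z‖ ≤ M := by
  have hS : MeromorphicAt S 0 := meromorphicAt_of_meromorphicOrderAt_ne_zero (by
    rw [h]; exact_mod_cast hn0)
  obtain ⟨k, hk, -, he⟩ := (meromorphicOrderAt_eq_int_iff hS).1 h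
  obtain ⟨m, hm⟩ := Int.eq_ofNat_of_zero_le (show 0 ≤ n + 2 by omega)
  have hc : ContinuousAt (fun z => ‖z ^ m * k z‖) 0 :=
    ((continuousAt_id.pow m).mul hk.continuousAt).norm
  refine ⟨‖(0 : ℂ) ^ m * k 0‖ + 1, ?_⟩
  filter_upwards [he, self_mem_nhdsWithin,
    (hc.eventually_lt_const (lt_add_one _)).filter_mono nhdsWithin_le_nhds] with z h1 h2 h3
  refine le_trans (le_of_eq ?_) h3.le
  have h2' : z ≠ 0 := h2
  rw [h1, sub_zero, smul_eq_mul, ← mul_assoc, ← zpow_natCast z m, ← hm,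
    zpow_add₀ h2', mul_comm (z ^ n)]
  rfl

theorem hasLaurentExpansion_of_sq_mul {φ A : ℂ → ℂ} (hA : AnalyticAt ℂ A 0)
    (h : ∀ᶠ z in 𝓝[≠] (0 : ℂ), z ^ 2 * φ z = A z) : HasLaurentExpansion φ (taylorCoeff A) := by
  unfold HasLaurentExpansion
  filter_upwards [h, hA.eventually_hasSum_taylorCoeff.filter_mono nhdsWithin_le_nhds,
    self_mem_nhdsWithin] with z h1 h2 h3
  have h3' : z ≠ 0 := h3
  have : φ z = A z * (z ^ 2)⁻¹ := by rw [← h1]; field_simp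
  rw [this]
  refine (h2.mul_right _).congr_fun fun n => ?_
  rw [zpow_sub₀ h3', zpow_natCast, mul_assoc, div_eq_mul_inv]
  rfl

/-- A locally injective holomorphic map whose Schwarzian derivative has a pole of order at most
two at the origin extends holomorphically, and the pole has order exactly two. -/
theorem extension_and_expansion_of_pole {f : ℂ → OnePoint ℂ}
    (hf : HolomorphicOn f puncturedDisc) (hinj : LocallyInjectiveOn f puncturedDisc)
    {n : ℤ} (hn : -2 ≤ n) (hn0 : n < 0) (h : meromorphicOrderAt (schwarzian f) 0 = n) :
    n = -2 ∧ (∃ F : ℂ → OnePoint ℂ, EqOn F f puncturedDisc ∧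
        HolomorphicOn F (Metric.ball 0 1) ∧ IsCriticalPoint F 0) ∧
      ∃ d : ℕ, 2 ≤ d ∧ ∃ a : ℕ → ℂ, HasLaurentExpansion (schwarzian f) a ∧
        a 0 = (1 - (d : ℂ) ^ 2) / 2 ∧ (coefficientMatrix d a).det = 0 := by
  obtain ⟨M, hM⟩ := exists_norm_sq_mul_le_of_meromorphicOrderAt hn hn0.ne h
  have hg := meromorphicAt_zero_of_isLocalCoordinateWith
    (fun z hz => isLocalCoordinateWith_coordFinite hf hinj hz) hM
  obtain ⟨F, H, hFf, hF, hH, hH', hS, hcrit⟩ := exists_holomorphic_extension hf hinj hg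
  obtain ⟨d, hd, hd1, hd2, A, hA, hA0, hAS, hdet⟩ := exists_schwarzianFinite_expansion hH hH'
  have hSA : ∀ᶠ z in 𝓝[≠] (0 : ℂ), z ^ 2 * schwarzian f z = A z := by
    filter_upwards [hS, hAS] with z h1 h2
    rw [h1, h2]
  -- For `d = 1` the map `H` is a local coordinate at `0`, so the Schwarzian would have no pole.
  have hdne : d ≠ 1 := by
    intro e
    have := (hH.schwarzianFinite (hd1 e)).meromorphicOrderAt_nonneg
    rw [← meromorphicOrderAt_congr hS, h] at this
    exact absurd (by exact_mod_cast this) hn0.not_ge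
  have hd' : 2 ≤ d := by omega
  have hSm : MeromorphicAt (schwarzian f) 0 := meromorphicAt_of_meromorphicOrderAt_ne_zero (by
    rw [h]; exact_mod_cast hn0.ne)
  -- Since `d ≥ 2`, `1 - d² ≠ 0`: the order is exactly `-2`, which excludes a simple pole.
  have hA0' : A 0 ≠ 0 := by
    rw [hA0]
    intro e
    have : (d : ℂ) ^ 2 = 1 := by linear_combination -2 * e
    have : d ^ 2 = 1 := by exact_mod_cast this
    nlinarith
  have horder : meromorphicOrderAt (schwarzian f) 0 = ((-2 : ℤ) : WithTop ℤ) := by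
    rw [meromorphicOrderAt_eq_int_iff hSm]
    refine ⟨A, hA, hA0', ?_⟩
    filter_upwards [hSA, self_mem_nhdsWithin] with z h1 h2
    have h2' : z ≠ 0 := h2
    rw [← h1, sub_zero, smul_eq_mul, zpow_neg]
    field_simp
  refine ⟨?_, ⟨F, hFf, hF, hcrit (hd2 hd')⟩, d, hd', taylorCoeff A,
    hasLaurentExpansion_of_sq_mul hA hSA, by rw [taylorCoeff_zero, hA0], hdet⟩
  rw [h] at horder
  exact_mod_cast horder

open RiemannSphere in
theorem theorem4p1 (f : ℂ → OnePoint ℂ)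
    (hf : HolomorphicOn f puncturedDisc) (hinj : LocallyInjectiveOn f puncturedDisc) :
    -- the origin is never a simple pole
    meromorphicOrderAt (schwarzian f) 0 ≠ ((-1 : ℤ) : WithTop ℤ) ∧
    -- if the origin is a double pole
    (meromorphicOrderAt (schwarzian f) 0 = ((-2 : ℤ) : WithTop ℤ) →
      (∃ F : ℂ → OnePoint ℂ, EqOn F f puncturedDisc ∧
        HolomorphicOn F (Metric.ball 0 1) ∧ IsCriticalPoint F 0) ∧
      ∃ d : ℕ, 2 ≤ d ∧ ∃ a : ℕ → ℂ, HasLaurentExpansion (schwarzian f) a ∧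
        a 0 = (1 - (d : ℂ) ^ 2) / 2 ∧ (coefficientMatrix d a).det = 0) := by
  refine ⟨fun h => ?_, fun h => ?_⟩
  · have := (extension_and_expansion_of_pole hf hinj (by norm_num) (by norm_num) h).1
    omega
  · exact (extension_and_expansion_of_pole hf hinj le_rfl (by norm_num) h).2
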